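/- Let $d \ge 2$ be an integer and let $t$ be a real number with $\frac1d < t < \frac1{d-1}$. A brick is a closed box $\prod_{j=1}^d [a_j, a_j + \ell_j] \subset \mathbb{R}^d$ with all $\ell_j > 0$; its side lengths are $\ell_1,\dots,\ell_d$, and it is a cube of sidelength $\ell$ if $\ell_1 = \dots = \ell_d = \ell$. Then there is an integer $N_0 \ge 1$, depending only on $d$ and $t$, such that for every integer $n_0 \ge N_0$ the series $\sum_{n=n_0}^\infty \frac{1}{n^{dt}}$ converges and the cubes of sidelength $n^{-t}$, $n \ge n_0$, perfectly pack every cube $\Omega \subset \mathbb{R}^d$ of volume $\sum_{n=n_0}^\infty \frac{1}{n^{dt}}$. That is, there are cubes $Q_n \subseteq \Omega$ ($n \ge n_0$), with $Q_n$ of sidelength $n^{-t}$, whose interiors are pairwise disjoint and for which $\Omega \setminus \bigcup_{n \ge n_0} Q_n$ has Lebesgue measure $0$. -/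

import Mathlib

/-- `B` is a closed `d`-dimensional brick with positive side lengths `s 0, …, s (d - 1)` whose facets
are parallel to the coordinate hyperplanes: the side lengths may be distributed over the coordinate
axes in any order `σ`, and the minimal corner `a` is arbitrary. -/
def IsBrickWithSides {d : ℕ} (s : Fin d → ℝ) (B : Set (Fin d → ℝ)) : Prop :=
  (∀ j, 0 < s j) ∧
    ∃ (σ : Equiv.Perm (Fin d)) (a : Fin d → ℝ), B = Set.Icc a (fun j => a j + s (σ j))

/-- A cube is a brick with equal side lengths. -/
def IsCube {d : ℕ} (B : Set (Fin d → ℝ)) : Prop :=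
  ∃ L : ℝ, IsBrickWithSides (fun _ => L) B

/-- `P` is a packing in `Ω` of the bricks with side lengths `s i`, `i : ι`. -/
structure IsPackingIn {d : ℕ} {ι : Type*} (s : ι → Fin d → ℝ) (Ω : Set (Fin d → ℝ))
    (P : ι → Set (Fin d → ℝ)) : Prop where
  isBrick : ∀ i, IsBrickWithSides (s i) (P i)
  disjoint_interior : ∀ i j, i ≠ j → Disjoint (interior (P i)) (interior (P j))
  subset : ∀ i, P i ⊆ Ω

/-- The bricks with side lengths `s i`, `i : ι`, perfectly pack `Ω`: they have a packing in `Ω` whose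
complement in `Ω` has Lebesgue measure zero. -/
def PerfectlyPack {d : ℕ} {ι : Type*} (s : ι → Fin d → ℝ) (Ω : Set (Fin d → ℝ)) : Prop :=
  ∃ P : ι → Set (Fin d → ℝ), IsPackingIn s Ω P ∧ MeasureTheory.volume (Ω \ ⋃ i, P i) = 0

/-! The cubes are placed greedily, in order of decreasing size, and the empty space is kept as a
finite family of separated boxes. Since the volume of `Ω` equals the total volume of the cubes, an
infinite packing is automatically perfect; the only danger is that at some stage `N` no empty box
can hold the next cubes.

This is excluded by an invariant on the regularized surface area `∑ boxWeight ε`. A box with some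
side at most `θ` has volume at most `θ ^ (1 - ε)` times its weight (`prod_le_mul_boxWeight`). The
empty volume at stage `N` is at least of order `N ^ (1 - d * t)`, the volume of the cubes still to
come. So if the total weight is at most `K * N ^ (c / 2)`, with `c = 1 - (d - 1) * t > 0` and
suitable `ε`, some box has all sides at least `θ = N ^ (-t + c * ε)`, slightly more than the cube
side `s = N ^ (-t)`.

One layer of `k ≤ N ^ (1 - c)` cubes goes into a grid of mesh `s` along one facet of that box. In so
short a run the sides vary by at most `g = N ^ (-t - c)`, so the gaps around the cubes are thin. The
weight grows by `O(N ^ (c / 2 - 1))` per cube (`exists_layer_packing_rpow`); by concavity of `x ^ (c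
/ 2)` the invariant survives (`rpow_add_mul_rpow_le`). -/

/-- A closed, possibly degenerate, axis-parallel box given by its extreme corners. -/
structure Brick (d : ℕ) where
  lo : Fin d → ℝ
  hi : Fin d → ℝ
  le : ∀ j, lo j ≤ hi j

/-! ### Boxes, collars and grid cells -/

namespace Brick

variable {d : ℕ}

/-- The length of the `j`-th side. -/
def side (B : Brick d) (j : Fin d) : ℝ := B.hi j - B.lo j

/-- The volume. -/
def vol (B : Brick d) : ℝ := ∏ j, B.side j

/-- Two boxes are separated by a coordinate hyperplane. -/
def Sep (B C : Brick d) : Prop := ∃ j, B.hi j ≤ C.lo j ∨ C.hi j ≤ B.lo j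

/-- Containment of boxes, in terms of the corners. -/
def Sub (B C : Brick d) : Prop := ∀ j, C.lo j ≤ B.lo j ∧ B.hi j ≤ C.hi j

theorem side_nonneg (B : Brick d) (j : Fin d) : 0 ≤ B.side j := sub_nonneg.2 (B.le j)

theorem Sep.symm {B C : Brick d} (h : B.Sep C) : C.Sep B := by
  obtain ⟨j, h | h⟩ := h
  · exact ⟨j, Or.inr h⟩
  · exact ⟨j, Or.inl h⟩

theorem Sub.refl (B : Brick d) : B.Sub B := fun _ => ⟨le_rfl, le_rfl⟩

theorem Sub.trans {A B C : Brick d} (h : A.Sub B) (h' : B.Sub C) : A.Sub C :=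
  fun j => ⟨(h' j).1.trans (h j).1, (h j).2.trans (h' j).2⟩

theorem Sub.side_le {B C : Brick d} (h : B.Sub C) (j : Fin d) : B.side j ≤ C.side j :=
  sub_le_sub (h j).2 (h j).1

theorem Sep.mono {A B A' B' : Brick d} (h : A.Sep B) (hA : A'.Sub A) (hB : B'.Sub B) :
    A'.Sep B' := by
  obtain ⟨j, h | h⟩ := h
  · exact ⟨j, Or.inl ((hA j).2.trans (h.trans (hB j).1))⟩
  · exact ⟨j, Or.inr ((hB j).2.trans (h.trans (hA j).1))⟩

/-- The sub-box sharing the minimal corner of `B` and with maximal corner `c`. -/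
def corner (B : Brick d) (c : Fin d → ℝ) (h : ∀ j, B.lo j ≤ c j) : Brick d := ⟨B.lo, c, h⟩

/-- The boxes which, together with the corner box, make up `B`. -/
def collar (B : Brick d) (c : Fin d → ℝ) (h : ∀ j, B.lo j ≤ c j) (h' : ∀ j, c j ≤ B.hi j)
    (i : Fin d) : Brick d where
  lo j := if j = i then c j else B.lo j
  hi j := if j < i then c j else B.hi j
  le j := by
    have := h j
    have := h' j
    have := B.le j
    split_ifs with h1 h2
    · exact absurd h2 (by rw [h1]; exact lt_irrefl _)
    all_goals assumption

variable {B : Brick d} {c : Fin d → ℝ} {h : ∀ j, B.lo j ≤ c j} {h' : ∀ j, c j ≤ B.hi j}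

theorem corner_sub (h' : ∀ j, c j ≤ B.hi j) : (B.corner c h).Sub B := fun j => ⟨le_rfl, h' j⟩

theorem collar_sub (i : Fin d) : (B.collar c h h' i).Sub B := by
  intro j
  have := h j
  have := h' j
  constructor
  · show B.lo j ≤ if j = i then c j else B.lo j
    split_ifs <;> linarith
  · show (if j < i then c j else B.hi j) ≤ B.hi j
    split_ifs <;> linarith

theorem corner_sep_collar (i : Fin d) : (B.corner c h).Sep (B.collar c h h' i) :=
  ⟨i, Or.inl (by simp [corner, collar])⟩

theorem collar_sep_of_lt {i i' : Fin d} (hi : i < i') :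
    (B.collar c h h' i').Sep (B.collar c h h' i) :=
  ⟨i, Or.inl (by simp [collar, hi])⟩

theorem collar_sep {i i' : Fin d} (hi : i ≠ i') :
    (B.collar c h h' i).Sep (B.collar c h h' i') := by
  rcases lt_or_gt_of_ne hi with hi | hi
  · exact (collar_sep_of_lt hi).symm
  · exact collar_sep_of_lt hi

theorem side_collar (i j : Fin d) : (B.collar c h h' i).side j =
    if j < i then c j - B.lo j else if j = i then B.hi j - c j else B.side j := by
  simp only [side, collar]
  split_ifs with h1 h2 h3
  · exact absurd h1 (by rw [h2]; exact lt_irrefl _)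
  all_goals rfl

/-- Collar `i` collects the points whose first coordinate beyond `c` is the `i`-th, so this is the
ordered telescoping expansion of `∏ (side - (hi - c))`. -/
theorem vol_corner_add : (B.corner c h).vol + ∑ i, (B.collar c h h' i).vol = B.vol := by
  have key := Finset.prod_sub_ordered (Finset.univ : Finset (Fin d)) B.side
    (fun j => B.hi j - c j)
  have e1 : ∀ j, B.side j - (B.hi j - c j) = c j - B.lo j := fun j => by simp [side]
  have e2 : ∀ i, (B.collar c h h' i).vol = (B.hi i - c i) *
      (∏ j with j < i, (c j - B.lo j)) * ∏ j with i < j, B.side j := by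
    intro i
    have : ∀ j, (B.collar c h h' i).side j = (if j = i then B.hi j - c j else 1) *
        (if j < i then c j - B.lo j else 1) * (if i < j then B.side j else 1) := by
      intro j
      rw [side_collar]
      rcases lt_trichotomy j i with hj | hj | hj
      · simp [hj, hj.ne, hj.le.not_gt]
      · simp [hj]
      · simp [hj, hj.ne', hj.le.not_gt]
    simp only [vol, this, Finset.prod_mul_distrib, Finset.prod_ite_eq', Finset.mem_univ,
      if_true, Finset.prod_filter]
  simp only [e1] at key
  simp only [e2]
  have : (B.corner c h).vol = ∏ j, (c j - B.lo j) := rfl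
  rw [this, key]
  simp [vol]

/-- The cell with index `κ` of the grid of mesh `s` based at the minimal corner of `B`. -/
def cell (B : Brick d) {s : ℝ} (hs : 0 ≤ s) (κ : Fin d → ℕ) : Brick d where
  lo j := B.lo j + κ j * s
  hi j := B.lo j + (κ j + 1) * s
  le j := by nlinarith

theorem side_cell {s : ℝ} (hs : 0 ≤ s) (κ : Fin d → ℕ) (j : Fin d) :
    (B.cell hs κ).side j = s := by
  simp only [side, cell]; ring

theorem cell_sep {s : ℝ} (hs : 0 ≤ s) {κ κ' : Fin d → ℕ} (hκ : κ ≠ κ') :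
    (B.cell hs κ).Sep (B.cell hs κ') := by
  obtain ⟨j, hj⟩ := Function.ne_iff.1 hκ
  have aux : ∀ a b : ℕ, a < b → B.lo j + ((a : ℝ) + 1) * s ≤ B.lo j + (b : ℝ) * s := by
    intro a b hab
    have : (a : ℝ) + 1 ≤ b := by exact_mod_cast hab
    nlinarith
  rcases lt_or_gt_of_ne hj with hj | hj
  · exact ⟨j, Or.inl (aux _ _ hj)⟩
  · exact ⟨j, Or.inr (aux _ _ hj)⟩

/-! ### Partial packings -/

/-- The boxes `P n`, `n₀ ≤ n < N`, are separated cubes in `W` with sides `r n`, and the separated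
boxes `Q i` fill up the rest of `W`. -/
structure IsPartialPacking (r : ℕ → ℝ) (W : Brick d) (n₀ N : ℕ) (P : ℕ → Brick d) {ι : Type}
    [Fintype ι] (Q : ι → Brick d) : Prop where
  le : n₀ ≤ N
  side_eq : ∀ n, n₀ ≤ n → n < N → ∀ j, (P n).side j = r n
  cube_sub : ∀ n, n₀ ≤ n → n < N → (P n).Sub W
  cube_sep : ∀ n n', n₀ ≤ n → n < n' → n' < N → (P n).Sep (P n')
  sep : ∀ n i, n₀ ≤ n → n < N → (P n).Sep (Q i)
  rest_sep : ∀ i i', i ≠ i' → (Q i).Sep (Q i')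
  rest_sub : ∀ i, (Q i).Sub W
  vol_eq : ∑ n ∈ Finset.Ico n₀ N, r n ^ d + ∑ i, (Q i).vol = W.vol

theorem IsPartialPacking.trivial (r : ℕ → ℝ) (W : Brick d) (n₀ : ℕ) (P : ℕ → Brick d) :
    IsPartialPacking r W n₀ n₀ P (fun _ : Unit => W) where
  le := le_rfl
  side_eq n h h' := absurd h' h.not_gt
  cube_sub n h h' := absurd h' h.not_gt
  cube_sep n n' h h' h'' := by omega
  sep n i h h' := absurd h' h.not_gt
  rest_sep i i' hi := absurd rfl hi
  rest_sub _ := Sub.refl W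
  vol_eq := by simp

/-- One empty box serves as the container for the next cubes, and what they leave over replaces it.
Cubes already placed are not moved, which later allows a limit. -/
theorem IsPartialPacking.glue {r : ℕ → ℝ} {W : Brick d} {n₀ N N' : ℕ} {P P' : ℕ → Brick d}
    {ι ι' : Type} [Fintype ι] [DecidableEq ι] [Fintype ι'] {Q : ι → Brick d} {Q' : ι' → Brick d}
    (hP : IsPartialPacking r W n₀ N P Q) (i₀ : ι)
    (hP' : IsPartialPacking r (Q i₀) N N' P' Q') :
    IsPartialPacking r W n₀ N' (fun n => if n < N then P n else P' n)
      (Sum.elim Q' (fun i : {i // i ≠ i₀} => Q i)) where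
  le := hP.le.trans hP'.le
  side_eq n h h' := by
    by_cases hn : n < N
    · simpa [hn] using hP.side_eq n h hn
    · simpa [hn] using hP'.side_eq n (not_lt.1 hn) h'
  cube_sub n h h' := by
    by_cases hn : n < N
    · simpa [hn] using hP.cube_sub n h hn
    · simpa [hn] using (hP'.cube_sub n (not_lt.1 hn) h').trans (hP.rest_sub i₀)
  cube_sep n n' h h' h'' := by
    by_cases hn' : n' < N
    · simpa [hn', h'.trans hn'] using hP.cube_sep n n' h h' hn'
    by_cases hn : n < N
    · simpa [hn', hn] using (hP.sep n i₀ h hn).mono (Sub.refl _)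
        (hP'.cube_sub n' (not_lt.1 hn') h'')
    · simpa [hn', hn] using hP'.cube_sep n n' (not_lt.1 hn) h' h''
  sep n i h h' := by
    by_cases hn : n < N
    · simp only [hn, if_true]
      rcases i with i | i
      · exact (hP.sep n i₀ h hn).mono (Sub.refl _) (hP'.rest_sub i)
      · exact hP.sep n i h hn
    · simp only [hn, if_false]
      rcases i with i | i
      · exact hP'.sep n i (not_lt.1 hn) h'
      · exact (hP.rest_sep i₀ i i.2.symm).mono (hP'.cube_sub n (not_lt.1 hn) h') (Sub.refl _)
  rest_sep i i' hi := by
    rcases i with i | i <;> rcases i' with i' | i'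
    · exact hP'.rest_sep i i' (fun e => hi (by rw [e]))
    · exact (hP.rest_sep i₀ i' i'.2.symm).mono (hP'.rest_sub i) (Sub.refl _)
    · exact (hP.rest_sep i i₀ i.2).mono (Sub.refl _) (hP'.rest_sub i')
    · exact hP.rest_sep i i' (fun e => hi (by rw [Subtype.ext e]))
  rest_sub i := by
    rcases i with i | i
    · exact (hP'.rest_sub i).trans (hP.rest_sub i₀)
    · exact hP.rest_sub i
  vol_eq := by
    rw [Fintype.sum_sum_type, ← Finset.sum_Ico_consecutive _ hP.le hP'.le]
    have h1 := hP.vol_eq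
    have h2 := hP'.vol_eq
    rw [Fintype.sum_eq_add_sum_subtype_ne (fun i => (Q i).vol) i₀] at h1
    simp only [Sum.elim_inl, Sum.elim_inr]
    linarith

section Grid

variable {s : ℝ} {m : Fin d → ℕ}

theorem cell_sub_corner (hs : 0 ≤ s) (h : ∀ j, B.lo j ≤ B.lo j + m j * s)
    (κ : ∀ j, Fin (m j)) :
    (B.cell hs (fun j => κ j)).Sub (B.corner (fun j => B.lo j + m j * s) h) := by
  intro j
  have : ((κ j : ℕ) : ℝ) + 1 ≤ m j := by exact_mod_cast (κ j).2
  have h0 : (0 : ℝ) ≤ ((κ j : ℕ) : ℝ) := Nat.cast_nonneg _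
  constructor
  · show B.lo j ≤ B.lo j + _ * s
    nlinarith
  · show B.lo j + (_ + 1) * s ≤ B.lo j + m j * s
    nlinarith

/-- Placing one cube into each cell of a grid yields a partial packing, whose remaining boxes are
the collars of the grid and of the cubes. -/
theorem exists_grid_packing (hs : 0 ≤ s) (hm : ∀ j, m j * s ≤ B.side j) {k : ℕ}
    (hk : k = ∏ j, m j) (N : ℕ) (r : ℕ → ℝ)
    (hr : ∀ n, N ≤ n → n < N + k → 0 ≤ r n ∧ r n ≤ s) :
    ∃ (P : ℕ → Brick d) (Q : Fin d ⊕ (Fin k × Fin d) → Brick d),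
      IsPartialPacking r B N (N + k) P Q ∧
      (∀ i j, (Q (Sum.inl i)).side j =
        if j < i then m j * s else if j = i then B.side j - m j * s else B.side j) ∧
      ∀ (κ : Fin k) (i j : Fin d), (Q (Sum.inr (κ, i))).side j ≤
        if j = i then s - r (N + κ) else s := by
  subst hk
  have hc : ∀ j, B.lo j ≤ B.lo j + m j * s := fun j => by
    have : (0 : ℝ) ≤ m j := Nat.cast_nonneg _
    nlinarith
  have hc' : ∀ j, B.lo j + m j * s ≤ B.hi j := fun j => by
    have := hm j
    simp only [side] at this
    linarith
  let e : Fin (∏ j, m j) ≃ (∀ j, Fin (m j)) :=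
    (Fintype.equivFinOfCardEq (by simp)).symm
  let D : Fin (∏ j, m j) → Brick d := fun k => B.cell hs (fun j => e k j)
  have hDsub : ∀ k, (D k).Sub (B.corner _ hc) := fun k => cell_sub_corner hs hc (e k)
  have hDsep : ∀ k k', k ≠ k' → (D k).Sep (D k') := by
    intro k k' hk
    apply cell_sep
    intro h
    apply hk
    apply e.injective
    funext j
    exact Fin.ext (congrFun h j)
  have hrk : ∀ k : Fin (∏ j, m j), 0 ≤ r (N + k) ∧ r (N + k) ≤ s := fun k =>
    hr _ (by omega) (by have := k.2; omega)
  have hq : ∀ k j, (D k).lo j ≤ (D k).lo j + r (N + k) := fun k j => by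
    linarith [(hrk k).1]
  have hq' : ∀ k j, (D k).lo j + r (N + k) ≤ (D k).hi j := fun k j => by
    have h1 : (D k).side j = s := side_cell hs _ j
    simp only [side] at h1
    linarith [(hrk k).2]
  let C : Fin (∏ j, m j) → Brick d := fun k => (D k).corner _ (hq k)
  have hCD : ∀ k, (C k).Sub (D k) := fun k => corner_sub (hq' k)
  -- Outside the range `N ≤ n < N + k` the value is irrelevant; `B` is a filler.
  let P : ℕ → Brick d := fun n => if hn : n - N < ∏ j, m j then C ⟨n - N, hn⟩ else B
  have hP : ∀ n, N ≤ n → n < N + ∏ j, m j → ∃ k : Fin (∏ j, m j), n = N + k ∧ P n = C k := by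
    intro n hn hn'
    have : n - N < ∏ j, m j := by omega
    exact ⟨⟨n - N, this⟩, by simp; omega, by simp [P, this]⟩
  let Q : Fin d ⊕ (Fin (∏ j, m j) × Fin d) → Brick d :=
    Sum.elim (B.collar _ hc hc') (fun p => (D p.1).collar _ (hq p.1) (hq' p.1) p.2)
  have hQD : ∀ k i, (Q (Sum.inr (k, i))).Sub (D k) :=
    fun k i => collar_sub (h := hq k) (h' := hq' k) i
  refine ⟨P, Q, ⟨by omega, ?_, ?_, ?_, ?_, ?_, ?_, ?_⟩, ?_, ?_⟩
  · intro n hn hn' j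
    obtain ⟨k, rfl, e⟩ := hP n hn hn'
    rw [e]
    simp [C, corner, side]
  · intro n hn hn'
    obtain ⟨k, rfl, e⟩ := hP n hn hn'
    rw [e]
    exact ((hCD k).trans (hDsub k)).trans (corner_sub hc')
  · intro n n' h1 h2 h3
    obtain ⟨k, rfl, e⟩ := hP n h1 (h2.trans h3)
    obtain ⟨k', rfl, e'⟩ := hP n' (h1.trans h2.le) h3
    rw [e, e']
    exact (hDsep k k' (fun h => by simp [h] at h2)).mono (hCD k) (hCD k')
  · intro n i hn hn'
    obtain ⟨k, rfl, e⟩ := hP n hn hn'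
    rw [e]
    rcases i with i | ⟨k', i⟩
    · exact (corner_sep_collar (h' := hc') i).mono ((hCD k).trans (hDsub k)) (Sub.refl _)
    · by_cases hk : k = k'
      · subst hk
        exact corner_sep_collar (h' := hq' k) i
      · exact (hDsep k k' hk).mono (hCD k) (hQD k' i)
  · intro i i' hi
    rcases i with i | ⟨k, i⟩ <;> rcases i' with i' | ⟨k', i'⟩
    · exact collar_sep (h := hc) (h' := hc') (fun h => hi (by rw [h]))
    · exact (corner_sep_collar (h' := hc') i).symm.mono (Sub.refl _) ((hQD k' i').trans (hDsub k'))
    · exact (corner_sep_collar (h' := hc') i').mono ((hQD k i).trans (hDsub k)) (Sub.refl _)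
    · by_cases hk : k = k'
      · subst hk
        exact collar_sep (h := hq k) (h' := hq' k) (fun h : i = i' => hi (by rw [h]))
      · exact (hDsep k k' hk).mono (hQD k i) (hQD k' i')
  · intro i
    rcases i with i | ⟨k, i⟩
    · exact collar_sub (h := hc) (h' := hc') i
    · exact ((hQD k i).trans (hDsub k)).trans (corner_sub hc')
  · have h1 : ∀ k : Fin (∏ j, m j), r (N + k) ^ d +
        ∑ i, (Q (Sum.inr (k, i))).vol = s ^ d := by
      intro k
      have h2 := vol_corner_add (B := D k) (h := hq k) (h' := hq' k)
      have h3 : (D k).vol = s ^ d := by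
        simp only [vol, D, side_cell, Finset.prod_const, Finset.card_univ, Fintype.card_fin]
      have h4 : ((D k).corner _ (hq k)).vol = r (N + k) ^ d := by
        simp [vol, side, corner]
      rw [h3, h4] at h2
      exact h2
    have h5 : (B.corner _ hc).vol = (∏ j, m j : ℕ) * s ^ d := by
      simp [vol, side, corner, Finset.prod_mul_distrib]
    have h6 := vol_corner_add (B := B) (h := hc) (h' := hc')
    have h7 : ∑ k : Fin (∏ j, m j), (r (N + k) ^ d + ∑ i, (Q (Sum.inr (k, i))).vol) =
        (∏ j, m j : ℕ) * s ^ d := by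
      rw [Finset.sum_congr rfl (fun k _ => h1 k)]
      simp
    rw [Fintype.sum_sum_type, Fintype.sum_prod_type, Finset.sum_Ico_eq_sum_range,
      Nat.add_sub_cancel_left, Finset.sum_range, ← h6, h5, ← h7, Finset.sum_add_distrib]
    simp only [Q, Sum.elim_inl]
    ring
  · intro i j
    simp only [Q, Sum.elim_inl, side_collar]
    split_ifs <;> simp [side]; ring
  · intro k i j
    have h1 : (D k).side j = s := side_cell hs _ j
    simp only [Q, Sum.elim_inr, side_collar, h1]
    simp only [side] at h1
    have := (hrk k).2
    split_ifs with h2 h3 h4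
    · exact absurd h3 h2.ne
    all_goals linarith [(hrk k).1]

end Grid

end Brick

/-! ### The weight of a box -/

open Finset in
/-- A regularized surface area of a box with side lengths `L`. -/
noncomputable def boxWeight {d : ℕ} (ε : ℝ) (L : Fin d → ℝ) : ℝ :=
  ∑ j, L j ^ ε * ∏ i ∈ univ.erase j, L i

section Weight

variable {d : ℕ} {ε : ℝ} {L u : Fin d → ℝ}

theorem boxWeight_mono (hε : 0 ≤ ε) (hL : ∀ j, 0 ≤ L j) (hu : ∀ j, L j ≤ u j) :
    boxWeight ε L ≤ boxWeight ε u := by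
  refine Finset.sum_le_sum fun j _ => mul_le_mul (Real.rpow_le_rpow (hL j) (hu j) hε)
    (Finset.prod_le_prod (fun i _ => hL i) fun i _ => hu i)
    (Finset.prod_nonneg fun i _ => hL i) (Real.rpow_nonneg ((hL j).trans (hu j)) _)

/-- Each term for `u` is `u j ^ (ε - 1) * ∏ u`, and the exponent is nonpositive. Enlarging `L` to
`u` first keeps the bound useful for boxes with very short or zero sides. -/
theorem boxWeight_le {r : ℝ} (hε : 0 ≤ ε) (hε1 : ε ≤ 1) (hr : 0 < r) (hL : ∀ j, 0 ≤ L j)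
    (hu : ∀ j, L j ≤ u j) (hru : ∀ j, r ≤ u j) :
    boxWeight ε L ≤ d * (r ^ (ε - 1) * ∏ j, u j) := by
  refine (boxWeight_mono hε hL hu).trans ?_
  have : ∀ j ∈ (Finset.univ : Finset (Fin d)),
      u j ^ ε * ∏ i ∈ Finset.univ.erase j, u i ≤ r ^ (ε - 1) * ∏ i, u i := by
    intro j _
    have hj : 0 < u j := hr.trans_le (hru j)
    rw [← Finset.mul_prod_erase Finset.univ u (Finset.mem_univ j), ← mul_assoc]
    refine mul_le_mul_of_nonneg_right ?_
      (Finset.prod_nonneg fun i _ => hr.le.trans (hru i))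
    have : u j ^ ε = u j ^ (ε - 1) * u j := by
      rw [← Real.rpow_add_one hj.ne']; ring_nf
    rw [this]
    exact mul_le_mul_of_nonneg_right
      (Real.rpow_le_rpow_of_nonpos hr (hru j) (by linarith)) hj.le
  refine (Finset.sum_le_sum this).trans ?_
  simp

/-- The `j`-th term of the weight alone suffices: it misses the volume by the factor `L j ^ (1 - ε)
≤ θ ^ (1 - ε)`. -/
theorem prod_le_mul_boxWeight {θ : ℝ} (hε1 : ε ≤ 1) (hL : ∀ j, 0 ≤ L j) {j : Fin d}
    (hj : L j ≤ θ) : ∏ i, L i ≤ θ ^ (1 - ε) * boxWeight ε L := by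
  have hθ : 0 ≤ θ := (hL j).trans hj
  have hterm : ∀ i, 0 ≤ L i ^ ε * ∏ i' ∈ Finset.univ.erase i, L i' := fun i =>
    mul_nonneg (Real.rpow_nonneg (hL i) _) (Finset.prod_nonneg fun i _ => hL i)
  have h1 : L j ^ ε * ∏ i' ∈ Finset.univ.erase j, L i' ≤ boxWeight ε L :=
    Finset.single_le_sum (f := fun i => L i ^ ε * ∏ i' ∈ Finset.univ.erase i, L i')
      (fun i _ => hterm i) (Finset.mem_univ j)
  refine le_trans ?_ (mul_le_mul_of_nonneg_left h1 (Real.rpow_nonneg hθ _))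
  rw [← Finset.mul_prod_erase Finset.univ L (Finset.mem_univ j), ← mul_assoc]
  refine mul_le_mul_of_nonneg_right ?_ (Finset.prod_nonneg fun i _ => hL i)
  rcases (hL j).eq_or_lt with h0 | h0
  · rw [← h0]
    exact mul_nonneg (Real.rpow_nonneg hθ _) (Real.rpow_nonneg le_rfl _)
  · have : L j = L j ^ (1 - ε) * L j ^ ε := by
      rw [← Real.rpow_add h0]; simp
    nth_rewrite 1 [this]
    exact mul_le_mul_of_nonneg_right (Real.rpow_le_rpow h0.le hj (by linarith))
      (Real.rpow_nonneg h0.le _)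

end Weight

/-! ### Packing one layer of cubes into a wide box -/

namespace Brick

/-- A box all of whose sides are at least `θ` has a partial packing by one layer of cubes of sides
in `[s - g, s]`, with a small increase of the weight. -/
theorem exists_layer_packing {d : ℕ} (i₀ : Fin d) (hi₀ : ∀ j, i₀ ≤ j) {ε s θ g : ℝ} (hε : 0 ≤ ε)
    (hε1 : ε ≤ 1) (hs : 0 < s) (hsθ : s ≤ θ) (hg : 0 < g) (hgs : g ≤ s) (B : Brick d)
    (hB : ∀ j, θ ≤ B.side j) (hB1 : ∀ j, B.side j ≤ 1) (N : ℕ) (r : ℕ → ℝ) :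
    ∃ k : ℕ, 0 < k ∧ (k : ℝ) ≤ s⁻¹ ^ (d - 1) ∧
      ((∀ n, N ≤ n → n < N + k → s - g ≤ r n ∧ r n ≤ s) →
        ∃ (P : ℕ → Brick d) (ι : Type) (_ : Fintype ι) (Q : ι → Brick d),
          IsPartialPacking r B N (N + k) P Q ∧
          ∑ i, boxWeight ε (Q i).side ≤ boxWeight ε B.side +
            k * (d * (d * (s ^ (ε - 1) * ((2 * s) ^ d * (s / θ)))) +
              d * (d * (g ^ (ε - 1) * (g * s ^ (d - 1)))))) := by
  have hθ : 0 < θ := hs.trans_le hsθ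
  -- A single layer in direction `i₀`, as many cells as fit in the others. This keeps `k` at most
  -- `s⁻¹ ^ (d - 1)`.
  let m : Fin d → ℕ := fun j => if j = i₀ then 1 else ⌊B.side j / s⌋₊
  have hm0 : ∀ j, 1 ≤ m j := by
    intro j
    by_cases h : j = i₀
    · simp [m, h]
    · simp only [m, h, if_false]
      exact Nat.le_floor (by rw [Nat.cast_one, one_le_div hs]; exact hsθ.trans (hB j))
  have hm1 : ∀ j, (1 : ℝ) ≤ m j := fun j => by exact_mod_cast hm0 j
  have hms : ∀ j, m j * s ≤ B.side j := by
    intro j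
    by_cases h : j = i₀
    · simpa [m, h] using hsθ.trans (hB i₀)
    · simp only [m, h, if_false]
      exact (le_div_iff₀ hs).1 (Nat.floor_le (div_nonneg (B.side_nonneg j) hs.le))
  have hms' : ∀ j, j ≠ i₀ → B.side j ≤ m j * s + s := by
    intro j h
    have h1 := (Nat.lt_floor_add_one (B.side j / s)).le
    rw [div_le_iff₀ hs] at h1
    simp only [m, h, if_false]
    linarith
  have hk0 : 0 < ∏ j, m j := Finset.prod_pos fun j _ => hm0 j
  obtain ⟨k, hk⟩ : ∃ k, k = ∏ j, m j := ⟨_, rfl⟩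
  rw [← hk] at hk0
  refine ⟨k, hk0, ?_, ?_⟩
  · rw [hk, Nat.cast_prod, ← Finset.mul_prod_erase Finset.univ _ (Finset.mem_univ i₀)]
    have : ∏ j ∈ Finset.univ.erase i₀, (m j : ℝ) ≤ ∏ j ∈ Finset.univ.erase i₀, s⁻¹ := by
      refine Finset.prod_le_prod (fun j _ => Nat.cast_nonneg _) fun j _ => ?_
      rw [← one_div, le_div_iff₀ hs]
      exact (hms j).trans (hB1 j)
    simpa [m] using this
  · intro hr
    obtain ⟨P, Q, hPQ, hQ, hQ'⟩ := exists_grid_packing hs.le hms hk N r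
      (fun n h h' => ⟨by linarith [(hr n h h').1], (hr n h h').2⟩)
    refine ⟨P, _, inferInstance, Q, hPQ, ?_⟩
    rw [Fintype.sum_sum_type, Fintype.sum_prod_type]
    have hk1 : (1 : ℝ) ≤ k := by exact_mod_cast hk0
    set X := s ^ (ε - 1) * ((2 * s) ^ d * (s / θ)) with hX
    have hX0 : 0 ≤ X := by positivity
    -- The box beyond the layer need not be thin; monotonicity charges it to the old weight with
    -- constant exactly `1`.
    have h0 : boxWeight ε (Q (Sum.inl i₀)).side ≤ boxWeight ε B.side := by
      refine boxWeight_mono hε (side_nonneg _) fun j => (hPQ.rest_sub _).side_le j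
    have h1 : ∀ i, i ≠ i₀ → boxWeight ε (Q (Sum.inl i)).side ≤ d * (k * X) := by
      intro i hi
      -- The other collars have thickness at most `s`. Since `2 * s * m i ≥ θ`, the `i`-th entry is
      -- still at least `s`, while the product gains the factor `s / θ` over `(2 * s) ^ d * k`.
      let u : Fin d → ℝ := fun j => (2 * s) * m j * (if j = i then s / θ else 1)
      have hui : s ≤ u i := by
        have h2 : θ ≤ 2 * s * m i := by nlinarith [hB i, hms' i hi, hm1 i]
        simp only [u, if_true]
        rw [← mul_div_assoc, le_div_iff₀ hθ, mul_comm]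
        exact mul_le_mul_of_nonneg_right h2 hs.le
      have huj : ∀ j, j ≠ i → u j = 2 * s * m j := fun j hj => by simp [u, hj]
      have hprod : ∏ j, u j = (2 * s) ^ d * k * (s / θ) := by
        simp only [u, Finset.prod_mul_distrib, hk, Finset.prod_ite_eq', Finset.mem_univ, if_true,
          Finset.prod_const, Finset.card_univ, Fintype.card_fin, Nat.cast_prod, mul_pow]
      have h3 : k * X = s ^ (ε - 1) * ∏ j, u j := by rw [hprod, hX]; ring
      rw [h3]
      refine boxWeight_le hε hε1 hs (side_nonneg _) ?_ ?_
      · intro j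
        rw [hQ]
        split_ifs with hj hj'
        · rw [huj j hj.ne]
          nlinarith [hm1 j]
        · subst hj'
          linarith [hms' j hi]
        · rw [huj j hj']
          -- As `i₀` is the least index, every other collar has only the extent of the layer in
          -- direction `i₀`, never the full side of `B`.
          have hj0 : j ≠ i₀ := by
            rintro rfl
            exact hj (lt_of_le_of_ne (hi₀ i) (Ne.symm hi))
          nlinarith [hm1 j, hms' j hj0]
      · intro j
        by_cases hj : j = i
        · rw [hj]; exact hui
        · rw [huj j hj]
          nlinarith [hm1 j]
    have h2 : ∑ i, boxWeight ε (Q (Sum.inl i)).side ≤ boxWeight ε B.side + d * (d * (k * X)) := by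
      rw [← Finset.add_sum_erase Finset.univ _ (Finset.mem_univ i₀)]
      refine add_le_add h0 ((Finset.sum_le_sum (fun i hi => h1 i (Finset.ne_of_mem_erase hi))).trans ?_)
      rw [Finset.sum_const, nsmul_eq_mul]
      refine mul_le_mul_of_nonneg_right ?_ (by positivity)
      exact_mod_cast (Finset.card_le_univ _).trans (by simp)
    have h3 : ∀ (κ : Fin k) (i : Fin d), boxWeight ε (Q (Sum.inr (κ, i))).side ≤
        d * (g ^ (ε - 1) * (g * s ^ (d - 1))) := by
      intro κ i
      have hprod : ∏ j, (if j = i then g else s) = g * s ^ (d - 1) := by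
        rw [← Finset.mul_prod_erase Finset.univ _ (Finset.mem_univ i), if_pos rfl,
          Finset.prod_congr rfl (fun j hj => if_neg (Finset.ne_of_mem_erase hj))]
        simp
      rw [← hprod]
      refine boxWeight_le hε hε1 hg (side_nonneg _) ?_ ?_
      · intro j
        refine (hQ' κ i j).trans ?_
        have := (hr (N + κ) (by omega) (by have := κ.2; omega)).1
        split_ifs <;> linarith
      · intro j
        split_ifs <;> linarith
    have h4 : ∑ κ : Fin k, ∑ i : Fin d, boxWeight ε (Q (Sum.inr (κ, i))).side ≤
        k * (d * (d * (g ^ (ε - 1) * (g * s ^ (d - 1))))) := by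
      refine (Finset.sum_le_sum fun κ _ => Finset.sum_le_sum fun i _ => h3 κ i).trans ?_
      simp
    calc _ ≤ _ := add_le_add h2 h4
      _ = _ := by ring

end Brick

namespace Brick

variable {d : ℕ}

/-- A wide box has a partial packing by consecutive cubes of sides `n ^ (-t)`. -/
theorem exists_layer_packing_rpow (hd : 0 < d) {t c ε : ℝ} (ht0 : 0 ≤ t) (ht1 : t ≤ 1)
    (hc : c = 1 - ((d : ℝ) - 1) * t) (hc0 : 0 < c) (hε : 0 ≤ ε) (hε1 : ε ≤ 1) {N : ℕ} (hN : 0 < N)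
    (B : Brick d) (hB : ∀ j, (N : ℝ) ^ (-t + c * ε) ≤ B.side j) (hB1 : ∀ j, B.side j ≤ 1) :
    ∃ k : ℕ, 0 < k ∧ k ≤ N ∧
      ∃ (P : ℕ → Brick d) (ι : Type) (_ : Fintype ι) (Q : ι → Brick d),
        IsPartialPacking (fun n => (n : ℝ) ^ (-t)) B N (N + k) P Q ∧
        ∑ i, boxWeight ε (Q i).side ≤ boxWeight ε B.side +
          k * (d * d * (2 ^ d + 1) * (N : ℝ) ^ (c - (t + c) * ε - 1)) := by
  have hx : (0 : ℝ) < N := by exact_mod_cast hN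
  have hx1 : (1 : ℝ) ≤ N := by exact_mod_cast hN
  set x : ℝ := (N : ℝ) with hxN
  have hs : 0 < x ^ (-t) := Real.rpow_pos_of_pos hx _
  have hsθ : x ^ (-t) ≤ x ^ (-t + c * ε) :=
    Real.rpow_le_rpow_of_exponent_le hx1 (by nlinarith)
  have hg : 0 < x ^ (-t - c) := Real.rpow_pos_of_pos hx _
  have hgs : x ^ (-t - c) ≤ x ^ (-t) := Real.rpow_le_rpow_of_exponent_le hx1 (by linarith)
  obtain ⟨k, hk, hkN, H⟩ := exists_layer_packing ⟨0, hd⟩ (fun j => Nat.zero_le _) hε hε1 hs hsθ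
    hg hgs B hB hB1 N (fun n => (n : ℝ) ^ (-t))
  have hkc : (k : ℝ) ≤ x ^ (1 - c) := by
    -- This is where `c` comes from: a layer has at most `N ^ (1 - c)` cubes.
    have e : (x ^ (-t))⁻¹ ^ (d - 1) = x ^ (1 - c) := by
      rw [← Real.rpow_neg hx.le, ← Real.rpow_mul_natCast hx.le, Nat.cast_sub hd, hc]
      congr 1
      push_cast
      ring
    rwa [e] at hkN
  have hkx : (k : ℝ) ≤ x := hkc.trans (by
    conv_rhs => rw [← Real.rpow_one x]
    exact Real.rpow_le_rpow_of_exponent_le hx1 (by linarith))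
  refine ⟨k, hk, by rw [hxN] at hkx; exact_mod_cast hkx, ?_⟩
  obtain ⟨P, ι, _, Q, hPQ, hQ⟩ := H (by
    intro n hn hn'
    have hny : x ≤ n := by rw [hxN]; exact_mod_cast hn
    have hn0 : (0 : ℝ) < n := hx.trans_le hny
    have hnk : (n : ℝ) ≤ x + k := by rw [hxN]; exact_mod_cast hn'.le
    refine ⟨?_, Real.rpow_le_rpow_of_nonpos hx hny (by linarith)⟩
    -- From `n ≤ N + N ^ (1 - c)` follows `1 - N ^ (-c) ≤ N / n ≤ (N / n) ^ t`; multiplying by `N ^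
    -- (-t)` gives the gap bound `g = N ^ (-t - c)`.
    have h1 : x / n ≤ (x / n) ^ t := by
      conv_lhs => rw [← Real.rpow_one (x / n)]
      exact Real.rpow_le_rpow_of_exponent_ge (by positivity) ((div_le_one hn0).2 hny) ht1
    have h2 : 1 - x ^ (-c) ≤ x / n := by
      rw [le_div_iff₀ hn0]
      have h3 : x ^ (1 - c) = x * x ^ (-c) := by
        rw [sub_eq_add_neg, Real.rpow_add hx, Real.rpow_one]
      have h4 : 0 ≤ x ^ (-c) := Real.rpow_nonneg hx.le _
      have h5 : (n : ℝ) ≤ x + x * x ^ (-c) := by linarith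
      have h6 : x ^ (-c) * x ≤ x ^ (-c) * n := mul_le_mul_of_nonneg_left hny h4
      nlinarith
    have h7 : x ^ (-t) * (x / n) ^ t = (n : ℝ) ^ (-t) := by
      rw [Real.div_rpow hx.le hn0.le, Real.rpow_neg hx.le, Real.rpow_neg hn0.le]
      have := (Real.rpow_pos_of_pos hx t).ne'
      field_simp
    have h8 : x ^ (-t - c) = x ^ (-t) * x ^ (-c) := by
      rw [sub_eq_add_neg, Real.rpow_add hx]
    have := mul_le_mul_of_nonneg_left (h2.trans h1) hs.le
    rw [h7] at this
    rw [h8]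
    linarith)
  refine ⟨P, ι, inferInstance, Q, hPQ, hQ.trans (le_of_eq ?_)⟩
  -- The threshold `θ = N ^ (-t + c * ε)` makes the cost of the collars of the layer have the same
  -- exponent as that of the gaps around the cubes (`e2`).
  have e1 : (x ^ (-t)) ^ (ε - 1) * ((2 * x ^ (-t)) ^ d * (x ^ (-t) / x ^ (-t + c * ε))) =
      2 ^ d * x ^ (c - (t + c) * ε - 1) := by
    rw [mul_pow, ← Real.rpow_mul hx.le, ← Real.rpow_mul_natCast hx.le, ← Real.rpow_sub hx]
    rw [mul_left_comm, mul_assoc, ← Real.rpow_add hx, ← Real.rpow_add hx]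
    congr 2
    rw [hc]
    ring
  have e2 : (x ^ (-t - c)) ^ (ε - 1) * (x ^ (-t - c) * (x ^ (-t)) ^ (d - 1)) =
      x ^ (c - (t + c) * ε - 1) := by
    rw [← Real.rpow_mul hx.le, ← Real.rpow_mul_natCast hx.le, ← Real.rpow_add hx,
      ← Real.rpow_add hx, Nat.cast_sub hd, hc]
    congr 1
    push_cast
    ring
  rw [e1, e2]
  ring

/-! ### From finite stages to an infinite packing -/

/-- An infinite packing is obtained by extending partial packings with small weight. -/
theorem exists_packing_of_extension {r : ℕ → ℝ} {W : Brick d} {n₀ : ℕ} {ε : ℝ} {b : ℕ → ℝ}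
    (h0 : boxWeight ε W.side ≤ b n₀)
    (hstep : ∀ (N : ℕ) (P : ℕ → Brick d) (ι : Type) (_ : Fintype ι) (Q : ι → Brick d),
      IsPartialPacking r W n₀ N P Q → ∑ i, boxWeight ε (Q i).side ≤ b N →
      ∃ (N' : ℕ) (P' : ℕ → Brick d) (ι' : Type) (_ : Fintype ι') (Q' : ι' → Brick d),
        N < N' ∧ IsPartialPacking r W n₀ N' P' Q' ∧ ∑ i, boxWeight ε (Q' i).side ≤ b N' ∧
        ∀ n < N, P' n = P n) :
    ∃ P : ℕ → Brick d, (∀ n, n₀ ≤ n → (∀ j, (P n).side j = r n) ∧ (P n).Sub W) ∧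
      ∀ n n', n₀ ≤ n → n < n' → (P n).Sep (P n') := by
  let Good : ℕ × (ℕ → Brick d) → Prop := fun S =>
    ∃ (ι : Type) (_ : Fintype ι) (Q : ι → Brick d),
      IsPartialPacking r W n₀ S.1 S.2 Q ∧ ∑ i, boxWeight ε (Q i).side ≤ b S.1
  have hnext : ∀ S : {S // Good S}, ∃ S' : {S // Good S}, S.1.1 < S'.1.1 ∧
      ∀ n < S.1.1, S'.1.2 n = S.1.2 n := by
    rintro ⟨⟨N, P⟩, ι, _, Q, hQ, hb⟩
    obtain ⟨N', P', ι', _, Q', hN, hQ', hb', hP⟩ := hstep N P ι _ Q hQ hb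
    exact ⟨⟨(N', P'), ι', _, Q', hQ', hb'⟩, hN, hP⟩
  choose f hfN hfP using hnext
  let S : ℕ → {S // Good S} := fun i => f^[i] ⟨(n₀, fun _ => W), Unit, inferInstance, _,
    IsPartialPacking.trivial r W n₀ _, by simpa using h0⟩
  have hS : ∀ i, S (i + 1) = f (S i) := fun i => Function.iterate_succ_apply' f i _
  -- Each stage places at least one cube, so cube `n` is settled by stage `n + 1`.
  have hSN : ∀ i, i ≤ (S i).1.1 := by
    intro i
    induction i with
    | zero => exact Nat.zero_le _
    | succ i ih => rw [hS]; exact ih.trans_lt (hfN _)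
  have hmono : ∀ i l n, n < (S i).1.1 → n < (S (i + l)).1.1 ∧
      (S (i + l)).1.2 n = (S i).1.2 n := by
    intro i l n hn
    induction l with
    | zero => exact ⟨hn, rfl⟩
    | succ l ih =>
      rw [← add_assoc, hS]
      exact ⟨ih.1.trans (hfN _), (hfP _ n ih.1).trans ih.2⟩
  have hlim : ∀ i n, n < i → (S i).1.2 n = (S (n + 1)).1.2 n := by
    intro i n hn
    obtain ⟨l, rfl⟩ := Nat.exists_eq_add_of_lt hn
    rw [add_right_comm]
    exact (hmono (n + 1) l n (Nat.lt_of_succ_le (hSN (n + 1)))).2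
  refine ⟨fun n => (S (n + 1)).1.2 n, fun n hn => ?_, fun n n' hn hn' => ?_⟩
  · obtain ⟨ι, _, Q, hQ, -⟩ := (S (n + 1)).2
    have := Nat.lt_of_succ_le (hSN (n + 1))
    exact ⟨hQ.side_eq n hn this, hQ.cube_sub n hn this⟩
  · obtain ⟨ι, _, Q, hQ, -⟩ := (S (n' + 1)).2
    have := hQ.cube_sep n n' hn hn' (Nat.lt_of_succ_le (hSN (n' + 1)))
    rwa [hlim (n' + 1) n (by omega)] at this

/-- If every box is narrow, the total volume is controlled by the total weight. -/
theorem exists_wide {ι : Type} [Fintype ι] {Q : ι → Brick d} {ε θ : ℝ} (hε1 : ε ≤ 1)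
    (h : θ ^ (1 - ε) * ∑ i, boxWeight ε (Q i).side < ∑ i, (Q i).vol) :
    ∃ i, ∀ j, θ ≤ (Q i).side j := by
  by_contra! hcon
  refine h.not_ge ?_
  rw [Finset.mul_sum]
  refine Finset.sum_le_sum fun i _ => ?_
  obtain ⟨j, hj⟩ := hcon i
  exact prod_le_mul_boxWeight hε1 (side_nonneg _) hj.le

end Brick

/-! ### Numerical estimates and the greedy induction -/

/-- Bernoulli's inequality for `x / (x + k) = 1 - k / (x + k)`; the factor `2 ^ (α - 1)` comes from
`x + k ≤ 2 * x`. It pays for `k` increments of size `x ^ (α - 1)`. -/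
theorem rpow_add_mul_rpow_le {α x k : ℝ} (hα0 : 0 ≤ α) (hα1 : α ≤ 1) (hx : 0 < x) (hk : 0 ≤ k)
    (hkx : k ≤ x) : x ^ α + k * (α * 2 ^ (α - 1) * x ^ (α - 1)) ≤ (x + k) ^ α := by
  have hy : 0 < x + k := by linarith
  have h1 := rpow_one_add_le_one_add_mul_self (s := -(k / (x + k))) (p := α)
    (by rw [neg_le_neg_iff, div_le_one hy]; linarith) hα0 hα1
  have h2 : 1 + -(k / (x + k)) = x / (x + k) := by field_simp; ring
  have h3 : (x + k) ^ (α - 1) * (x + k) = (x + k) ^ α := by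
    rw [← Real.rpow_add_one hy.ne']; simp
  have h4 : (2 : ℝ) ^ (α - 1) * x ^ (α - 1) ≤ (x + k) ^ (α - 1) := by
    rw [← Real.mul_rpow (by norm_num) hx.le]
    exact Real.rpow_le_rpow_of_nonpos hy (by linarith) (by linarith)
  rw [h2, Real.div_rpow hx.le hy.le, div_le_iff₀ (Real.rpow_pos_of_pos hy _)] at h1
  have h5 : (1 + α * -(k / (x + k))) * (x + k) ^ α = (x + k) ^ α - α * k * (x + k) ^ (α - 1) := by
    rw [← h3]; field_simp; ring
  rw [h5] at h1
  have h6 := mul_le_mul_of_nonneg_left h4 (mul_nonneg hα0 hk)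
  nlinarith

/-- The tail from `N` contains `N` terms of index below `2 * N`. Monotonicity is asked only from `0
< m` on, since `1 / 0 ^ p = 0` for `p ≠ 0` in Lean. -/
theorem sum_Ico_add_le_tsum {f : ℕ → ℝ} (hf : Summable f) (h0 : ∀ n, 0 ≤ f n)
    (hanti : ∀ m n, 0 < m → m ≤ n → f n ≤ f m) {n₀ N : ℕ} (hN : n₀ ≤ N) :
    ∑ n ∈ Finset.Ico n₀ N, f n + N * f (2 * N) ≤ ∑' n : Set.Ici n₀, f n := by
  have h1 : ∑ n ∈ Finset.Ico n₀ (2 * N), f n ≤ ∑' n : Set.Ici n₀, f n := by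
    rw [tsum_subtype (Set.Ici n₀) f]
    have : ∑ n ∈ Finset.Ico n₀ (2 * N), f n =
        ∑ n ∈ Finset.Ico n₀ (2 * N), (Set.Ici n₀).indicator f n := by
      refine Finset.sum_congr rfl fun n hn => ?_
      rw [Set.indicator_of_mem]
      exact (Finset.mem_Ico.1 hn).1
    rw [this]
    exact (hf.indicator _).sum_le_tsum _ fun n _ => Set.indicator_nonneg (fun n _ => h0 n) n
  have h2 : (N : ℝ) * f (2 * N) ≤ ∑ n ∈ Finset.Ico N (2 * N), f n := by
    have := Finset.card_nsmul_le_sum (Finset.Ico N (2 * N)) f (f (2 * N)) fun n hn => by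
      rw [Finset.mem_Ico] at hn
      exact hanti _ _ (by omega) hn.2.le
    rw [Nat.card_Ico, nsmul_eq_mul] at this
    rwa [show 2 * N - N = N by omega] at this
  rw [← Finset.sum_Ico_consecutive f hN (by omega : N ≤ 2 * N)] at h1
  linarith

namespace Brick

theorem exists_cube_packing {d : ℕ} (hd : 2 ≤ d) {t : ℝ} (ht₁ : 1 / (d : ℝ) < t)
    (ht₂ : t < 1 / ((d : ℝ) - 1)) :
    ∃ N₀ : ℕ, 1 ≤ N₀ ∧ ∀ n₀, N₀ ≤ n₀ → ∀ W : Brick d, (∀ j, W.side j ≤ 1) →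
      W.vol = ∑' n : Set.Ici n₀, 1 / ((n : ℕ) : ℝ) ^ ((d : ℝ) * t) →
      ∃ P : ℕ → Brick d, (∀ n, n₀ ≤ n → (∀ j, (P n).side j = (n : ℝ) ^ (-t)) ∧ (P n).Sub W) ∧
        ∀ n n', n₀ ≤ n → n < n' → (P n).Sep (P n') := by
  have hd' : (2 : ℝ) ≤ d := by exact_mod_cast hd
  have ht0 : 0 < t := lt_trans (by positivity) ht₁
  have hdt : 1 < d * t := by
    rw [div_lt_iff₀ (by linarith)] at ht₁
    linarith
  have hdt' : ((d : ℝ) - 1) * t < 1 := by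
    rw [lt_div_iff₀ (by linarith)] at ht₂
    linarith
  have ht1 : t ≤ 1 := by nlinarith
  obtain ⟨c, hc⟩ : ∃ c : ℝ, c = 1 - ((d : ℝ) - 1) * t := ⟨_, rfl⟩
  have hc0 : 0 < c := by linarith
  have hc1 : c ≤ 1 := by nlinarith
  -- Chosen so that `c - (t + c) * ε = c / 2` is positive: the costs per cube then sum to a positive
  -- power of `N`.
  obtain ⟨ε, hε⟩ : ∃ ε : ℝ, ε = c / (2 * (t + c)) := ⟨_, rfl⟩
  have hε0 : 0 < ε := by rw [hε]; positivity
  have hε1 : ε ≤ 1 := by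
    rw [hε, div_le_one (by positivity)]
    linarith
  have hα : c - (t + c) * ε = c / 2 := by
    rw [hε]; field_simp; ring
  obtain ⟨C, hC⟩ : ∃ C : ℝ, C = (d * d * (2 ^ d + 1) : ℝ) := ⟨_, rfl⟩
  -- The summand `d` covers the initial weight; the other lets the growth of `K * N ^ (c / 2)`
  -- absorb the cost `C * N ^ (c / 2 - 1)` per cube.
  obtain ⟨K, hK⟩ : ∃ K : ℝ, K = d + C / (c / 2 * 2 ^ (c / 2 - 1)) := ⟨_, rfl⟩
  have hA : (0 : ℝ) < c / 2 * 2 ^ (c / 2 - 1) := by positivity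
  have hC0 : 0 ≤ C := by rw [hC]; positivity
  have hKd : d ≤ K := by
    rw [hK]; linarith [div_nonneg hC0 hA.le]
  have hK0 : 0 ≤ K := by linarith
  have hKC : C ≤ K * (c / 2 * 2 ^ (c / 2 - 1)) := by
    rw [hK, add_mul, div_mul_cancel₀ _ hA.ne']
    have : 0 ≤ (d : ℝ) * (c / 2 * 2 ^ (c / 2 - 1)) := by positivity
    linarith
  have hlim : ∀ᶠ N : ℕ in Filter.atTop,
      K * (N : ℝ) ^ (-(c * ε ^ 2)) < 2 ^ (-((d : ℝ) * t)) := by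
    have h1 := ((tendsto_rpow_neg_atTop (y := c * ε ^ 2) (by positivity)).comp
      tendsto_natCast_atTop_atTop).const_mul K
    rw [mul_zero] at h1
    exact h1.eventually_lt_const (by positivity)
  obtain ⟨N₁, hN₁⟩ := Filter.eventually_atTop.1 hlim
  refine ⟨max N₁ 1, le_max_right _ _, fun n₀ hn₀ W hW1 hWvol => ?_⟩
  have hn0 : 1 ≤ n₀ := (le_max_right _ _).trans hn₀
  refine exists_packing_of_extension (r := fun n => (n : ℝ) ^ (-t)) (ε := ε)
    (b := fun N => K * (N : ℝ) ^ (c / 2)) ?_ ?_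
  · have h1 : boxWeight ε W.side ≤ d := by
      simpa using boxWeight_le (u := fun _ => 1) hε0.le hε1 one_pos W.side_nonneg hW1
        (fun _ => le_rfl)
    have h2 : (1 : ℝ) ≤ (n₀ : ℝ) ^ (c / 2) :=
      Real.one_le_rpow (by exact_mod_cast hn0) (by positivity)
    show _ ≤ K * (n₀ : ℝ) ^ (c / 2)
    nlinarith
  · intro N P ι _ Q hPQ hb
    have hN : 1 ≤ N := hn0.trans hPQ.le
    have hx : (0 : ℝ) < N := by exact_mod_cast hN
    have hpow : ∀ n : ℕ, ((n : ℝ) ^ (-t)) ^ d = 1 / (n : ℝ) ^ ((d : ℝ) * t) := by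
      intro n
      rw [← Real.rpow_mul_natCast (Nat.cast_nonneg n), one_div,
        ← Real.rpow_neg (Nat.cast_nonneg n)]
      ring_nf
    have hvol : N * (1 / ((2 * N : ℕ) : ℝ) ^ ((d : ℝ) * t)) ≤ ∑ i, (Q i).vol := by
      have h1 := sum_Ico_add_le_tsum (f := fun n : ℕ => 1 / (n : ℝ) ^ ((d : ℝ) * t))
        (Real.summable_one_div_nat_rpow.2 hdt) (fun n => by positivity)
        (fun m n hm hmn => one_div_le_one_div_of_le
          (Real.rpow_pos_of_pos (by exact_mod_cast hm) _)
          (Real.rpow_le_rpow (Nat.cast_nonneg m) (by exact_mod_cast hmn) (by positivity)))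
        hPQ.le
      have h2 := hPQ.vol_eq
      simp only [hpow] at h2
      linarith
    have hwide : ∃ i, ∀ j, (N : ℝ) ^ (-t + c * ε) ≤ (Q i).side j := by
      refine exists_wide hε1 (lt_of_lt_of_le ?_ hvol)
      rw [← Real.rpow_mul hx.le]
      refine (mul_le_mul_of_nonneg_left hb (Real.rpow_nonneg hx.le _)).trans_lt ?_
      -- The narrow-box bound falls short of the remaining volume by the power `N ^ (-(c * ε ^ 2))`,
      -- which for large `N` beats `K` and `2 ^ (d * t)`.
      have e1 : (N : ℝ) ^ ((-t + c * ε) * (1 - ε)) * (K * (N : ℝ) ^ (c / 2)) =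
          K * (N : ℝ) ^ (-(c * ε ^ 2)) * (N : ℝ) ^ (1 - (d : ℝ) * t) := by
        rw [mul_left_comm, mul_assoc, ← Real.rpow_add hx, ← Real.rpow_add hx, ← hα]
        congr 2
        rw [hc]
        ring
      have e2 : (N : ℝ) * (1 / ((2 * N : ℕ) : ℝ) ^ ((d : ℝ) * t)) =
          2 ^ (-((d : ℝ) * t)) * (N : ℝ) ^ (1 - (d : ℝ) * t) := by
        push_cast
        rw [Real.mul_rpow (by norm_num) hx.le, Real.rpow_sub hx, Real.rpow_one,
          Real.rpow_neg (by norm_num)]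
        field_simp
      rw [e1, e2]
      exact mul_lt_mul_of_pos_right (hN₁ N ((le_max_left _ _).trans (hn₀.trans hPQ.le)))
        (Real.rpow_pos_of_pos hx _)
    obtain ⟨i, hi⟩ := hwide
    obtain ⟨k, hk0, hkN, P', ι', _, Q', hPQ', hb'⟩ := exists_layer_packing_rpow (by omega) ht0.le
      ht1 hc hc0 hε0.le hε1 hN (Q i) hi (fun j => ((hPQ.rest_sub i).side_le j).trans (hW1 j))
    classical
    refine ⟨N + k, _, _, inferInstance, _, by omega, hPQ.glue i hPQ', ?_,
      fun n hn => if_pos hn⟩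
    rw [Fintype.sum_sum_type]
    rw [Fintype.sum_eq_add_sum_subtype_ne (fun i => boxWeight ε (Q i).side) i] at hb
    simp only [Sum.elim_inl, Sum.elim_inr]
    rw [hα, ← hC] at hb'
    have h1 := rpow_add_mul_rpow_le (α := c / 2) (x := N) (k := k) (by positivity) (by linarith)
      hx (Nat.cast_nonneg k) (by exact_mod_cast hkN)
    have h2 := mul_le_mul_of_nonneg_left h1 hK0
    have h3 : (k : ℝ) * (C * (N : ℝ) ^ (c / 2 - 1)) ≤
        K * (k * (c / 2 * 2 ^ (c / 2 - 1) * (N : ℝ) ^ (c / 2 - 1))) := by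
      have := mul_le_mul_of_nonneg_right hKC
        (show 0 ≤ (k : ℝ) * (N : ℝ) ^ (c / 2 - 1) by positivity)
      calc _ = C * ((k : ℝ) * (N : ℝ) ^ (c / 2 - 1)) := by ring
        _ ≤ _ := this
        _ = _ := by ring
    push_cast
    linarith

end Brick

/-! ### Measure of the packing and the main theorem -/

open MeasureTheory

namespace Brick

variable {d : ℕ}

theorem Sep.disjoint_interior {B C : Brick d} (h : B.Sep C) :
    Disjoint (interior (Set.Icc B.lo B.hi)) (interior (Set.Icc C.lo C.hi)) := by
  rw [← Set.pi_univ_Icc, ← Set.pi_univ_Icc, interior_pi_set Set.finite_univ,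
    interior_pi_set Set.finite_univ]
  simp only [interior_Icc]
  rw [Set.disjoint_left]
  intro x hx hx'
  obtain ⟨j, h⟩ := h
  have h1 := hx j trivial
  have h2 := hx' j trivial
  rcases h with h | h
  · exact absurd (h1.2.trans_le h) h2.1.not_gt
  · exact absurd (h2.2.trans_le h) h1.1.not_gt

theorem volume_interior (B : Brick d) :
    volume (interior (Set.Icc B.lo B.hi)) = ENNReal.ofReal B.vol := by
  rw [← Set.pi_univ_Icc, interior_pi_set Set.finite_univ]
  simp only [interior_Icc]
  rw [Real.volume_pi_Ioo, vol, ENNReal.ofReal_prod_of_nonneg fun j _ => B.side_nonneg j]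
  rfl

end Brick

theorem theorem1p1 (d : ℕ) (hd : 2 ≤ d) (t : ℝ)
    (ht₁ : 1 / (d : ℝ) < t) (ht₂ : t < 1 / ((d : ℝ) - 1)) :
    ∃ N₀ : ℕ, 1 ≤ N₀ ∧ ∀ n₀ : ℕ, N₀ ≤ n₀ →
      Summable (fun n : Set.Ici n₀ => 1 / ((n : ℕ) : ℝ) ^ ((d : ℝ) * t)) ∧
      ∀ Ω : Set (Fin d → ℝ), IsCube Ω →
        MeasureTheory.volume Ω =
          ENNReal.ofReal (∑' n : Set.Ici n₀, 1 / ((n : ℕ) : ℝ) ^ ((d : ℝ) * t)) →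
        PerfectlyPack (fun (n : Set.Ici n₀) (_ : Fin d) => ((n : ℕ) : ℝ) ^ (-t)) Ω := by
  have hdt : 1 < d * t := by
    rw [div_lt_iff₀ (by positivity)] at ht₁
    linarith
  have hsum : Summable fun n : ℕ => 1 / (n : ℝ) ^ ((d : ℝ) * t) :=
    Real.summable_one_div_nat_rpow.2 hdt
  obtain ⟨N₁, hN₁, H⟩ := Brick.exists_cube_packing hd ht₁ ht₂
  -- Beyond `F` the tail of the series is at most `1`, which forces `L ≤ 1` as the greedy packing
  -- requires.
  obtain ⟨F, hF⟩ := Filter.eventually_atTop.1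
    ((tendsto_tsum_compl_atTop_zero fun n : ℕ => 1 / (n : ℝ) ^ ((d : ℝ) * t)).eventually_le_const
      one_pos)
  refine ⟨max N₁ (F.sup id + 1), le_max_of_le_left hN₁, fun n₀ hn₀ => ⟨hsum.subtype _, ?_⟩⟩
  rintro Ω ⟨L, hL, σ, a, rfl⟩ hvol
  have hL0 : 0 < L := hL ⟨0, by omega⟩
  have htail : ∑' n : Set.Ici n₀, 1 / ((n : ℕ) : ℝ) ^ ((d : ℝ) * t) ≤ 1 := by
    have h1 := hF (Finset.range n₀) fun n hn => by
      have : n ≤ F.sup id := Finset.le_sup (f := id) hn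
      have := (le_max_right N₁ _).trans hn₀
      exact Finset.mem_range.2 (by omega)
    refine le_trans (le_of_eq ?_) h1
    refine tsum_congr_set_coe (fun n : ℕ => 1 / (n : ℝ) ^ ((d : ℝ) * t))
      (t := {n | n ∉ Finset.range n₀}) ?_
    ext n
    simp
  have hsum' : Summable fun n : Set.Ici n₀ => 1 / ((n : ℕ) : ℝ) ^ ((d : ℝ) * t) :=
    hsum.subtype _
  have htail0 : 0 ≤ ∑' n : Set.Ici n₀, 1 / ((n : ℕ) : ℝ) ^ ((d : ℝ) * t) :=
    tsum_nonneg fun n => by positivity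
  let W : Brick d := ⟨a, fun j => a j + L, fun j => by linarith⟩
  have hWside : ∀ j, W.side j = L := fun j => by simp [W, Brick.side]
  have hWvol : W.vol = L ^ d := by simp [Brick.vol, hWside]
  have hvolW : W.vol = ∑' n : Set.Ici n₀, 1 / ((n : ℕ) : ℝ) ^ ((d : ℝ) * t) := by
    have h1 : volume (Set.Icc a fun j => a j + L) = ENNReal.ofReal W.vol := by
      rw [Real.volume_Icc_pi, hWvol]
      simp [ENNReal.ofReal_pow hL0.le]
    rw [h1] at hvol
    exact (ENNReal.ofReal_eq_ofReal_iff (by rw [hWvol]; positivity) htail0).1 hvol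
  have hL1 : L ≤ 1 := by
    rw [← hvolW, hWvol] at htail
    exact (pow_le_one_iff_of_nonneg hL0.le (by omega)).1 htail
  obtain ⟨P, hP, hPsep⟩ := H n₀ ((le_max_left _ _).trans hn₀) W
    (fun j => (hWside j).trans_le hL1) hvolW
  have hn0 : 0 < n₀ := hN₁.trans ((le_max_left _ _).trans hn₀)
  have hdisj : ∀ n n' : Set.Ici n₀, n ≠ n' →
      Disjoint (interior (Set.Icc (P n).lo (P n).hi))
        (interior (Set.Icc (P n').lo (P n').hi)) := by
    intro n n' hne
    rcases lt_or_gt_of_ne hne with h | h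
    · exact (hPsep n n' n.2 h).disjoint_interior
    · exact (hPsep n' n n'.2 h).disjoint_interior.symm
  have hsub : ∀ n : Set.Ici n₀, Set.Icc (P n).lo (P n).hi ⊆ Set.Icc a fun j => a j + L :=
    fun n => Set.Icc_subset_Icc (fun j => ((hP n n.2).2 j).1) fun j => ((hP n n.2).2 j).2
  refine ⟨fun n => Set.Icc (P n).lo (P n).hi, ⟨fun n => ⟨fun _ => ?_, 1, (P n).lo, ?_⟩,
    hdisj, hsub⟩, ?_⟩
  · exact Real.rpow_pos_of_pos (by exact_mod_cast hn0.trans_le n.2) _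
  · congr 1
    funext j
    rw [← (hP n n.2).1 j]
    simp [Brick.side]
  · have hpvol : ∀ n : Set.Ici n₀, (P n).vol = 1 / ((n : ℕ) : ℝ) ^ ((d : ℝ) * t) := by
      intro n
      rw [Brick.vol, Finset.prod_congr rfl fun j _ => (hP n n.2).1 j, Finset.prod_const,
        Finset.card_univ, Fintype.card_fin, ← Real.rpow_mul_natCast (Nat.cast_nonneg _), one_div,
        ← Real.rpow_neg (Nat.cast_nonneg _)]
      ring_nf
    -- Interiors are genuinely disjoint, so their volumes add up to that of `Ω`, and finiteness of
    -- this volume makes the complement null.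
    have hunion : volume (⋃ n : Set.Ici n₀, interior (Set.Icc (P n).lo (P n).hi)) =
        volume (Set.Icc a fun j => a j + L) := by
      rw [measure_iUnion (fun n n' h => hdisj n n' h) fun n => isOpen_interior.measurableSet, hvol,
        ENNReal.ofReal_tsum_of_nonneg (fun n => by positivity) hsum']
      exact tsum_congr fun n => by rw [Brick.volume_interior, hpvol]
    refine measure_mono_null (Set.sdiff_subset_sdiff_right
      (Set.iUnion_mono fun n => interior_subset)) ?_
    rw [measure_sdiff (Set.iUnion_subset fun n => interior_subset.trans (hsub n))
      (MeasurableSet.iUnion fun n => isOpen_interior.measurableSet).nullMeasurableSet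
      (by rw [hunion, hvol]; exact ENNReal.ofReal_ne_top), hunion, tsub_self]
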